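/- **Setting.** Let $\mathcal S$ be a subset of a Euclidean space, $\mathcal A$ a nonempty compact subset of a Euclidean space, $H\ge 1$ an integer, $[H]=\{1,\dots,H\}$, and let $\mu$ be a probability distribution on $\mathcal S$. Let $\mathcal B$ be a Banach space contained in the space $C(\mathcal S\times\mathcal A)$ of bounded continuous functions, with $\sup_{z}|g(z)|\le B\|g\|_{\mathcal B}$ for all $g\in\mathcal B$ and some constant $B>0$. Consider a family of episodic Markov decision processes $\mathcal M=\{M_\theta=(\mathcal S,\mathcal A,H,P_\theta,r_\theta,\mu):\theta\in\Theta\}$ with $\Theta=\Theta_P\times\Theta_r$, $\Theta_P\neq\emptyset$, where the transition probability $P_\theta(\cdot\,|\,h,s,a)$ depends only on $\theta_P$ (and is otherwise arbitrary), the mean reward $r_\theta(h,s,a)$ depends only on $\theta_r$, and $$\{r_{\theta_r}:\theta_r\in\Theta_r\}=\{r:\ r(h,\cdot,\cdot)\in\mathcal B,\ \|r(h,\cdot,\cdot)\|_{\mathcal B}\le 1\ \text{ for all } h\in[H]\}.$$ A policy $\pi=(\pi_h)_{h\in[H]}$ is a family of Markov kernels from $\mathcal S$ to $\mathcal A$.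 Let $\rho_{h,P,\pi,\mu}$ be the law of $(S_h,A_h)$ when $S_1\sim\mu$, $A_h\sim\pi_h(\cdot\,|\,S_h)$, $S_{h+1}\sim P(\cdot\,|\,h,S_h,A_h)$; let $\Pi(P,\mu)=\bigcup_{h\in[H]}\{\rho_{h,P,\pi,\mu}:\pi \text{ a policy}\}$ and $$J^*(M_\theta)=\sup_\pi\sum_{h=1}^H\int r_\theta(h,s,a)\,\mathrm d\rho_{h,P_\theta,\pi,\mu}(s,a).$$ **Algorithms.** Let $\epsilon_1,\epsilon_2,\dots$, $u_1,u_2,\dots$ and $\bar u$ be independent standard normal random variables on a probability space $(\Omega,\mathbb P)$, and for each $\theta\in\Theta$ let $p_\theta:[H]\times\mathcal S\times\mathcal A\times\mathbb R\to\mathcal S$ be a measurable function, depending only on $\theta_P$, with $p_\theta(h,s,a,u_i)\sim P_\theta(\cdot\,|\,h,s,a)$ for all $(h,s,a)$. An $n$-sample algorithm $\xi=(f_1,\dots,f_n,F)\in\Xi_n$ consists of measurable functions; run on $M_\theta$, it queries $(h_i,s_i,a_i)=f_i(\mathcal D_{i-1},\bar u)$, observes $x_i=p_\theta(h_i,s_i,a_i,u_i)$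 and $y_i=r_\theta(h_i,s_i,a_i)+\epsilon_i$, where $\mathcal D_i=\big((h_j,s_j,a_j,x_j,y_j)\big)_{j\le i}$, and returns $J_n^{\theta,\xi}=F(\mathcal D_n,\bar u)\in\mathbb R$. A sampling scheme $\bar\xi=(\bar f_1,\dots,\bar f_n)\in\bar\Xi_n$ consists of measurable functions and queries $(h_i,s_i,a_i)=\bar f_i(\bar{\mathcal D}_{i-1},\bar u)$ with $\bar{\mathcal D}_i=\big((h_j,s_j,a_j,x_j)\big)_{j\le i}$ and $x_i=p_\theta(h_i,s_i,a_i,u_i)$; put $\nu^{\theta,\bar\xi}=\frac1n\sum_{i=1}^n\mathrm{Law}(s_i,a_i)$. **Complexity.** For a set $\Pi$ of probability distributions and a probability distribution $\nu$ on $\mathcal S\times\mathcal A$ and $\epsilon>0$ let $$\mathcal R(\Pi,\mathcal B,\epsilon,\nu)=\sup\Big\{\Big|\int g\,\mathrm d\rho\Big| : g\in\mathcal B,\ \|g\|_{\mathcal B}\le 1,\ \|g\|_{L^2(\nu)}\le\epsilon,\ \rho\in\Pi\Big\},$$ $$\Delta_{\mathcal M}(\epsilon)=\inf_{\bar\xi\in\bar\Xi_{\lfloor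 1/\epsilon^2\rfloor}}\ \sup_{\theta\in\Theta}\ \mathcal R\big(\Pi(P_\theta,\mu),\mathcal B,\epsilon,\nu^{\theta,\bar\xi}\big).$$ **Theorem.** For every integer $n\ge 1$, $$\inf_{\xi\in\Xi_n}\sup_{\theta\in\Theta}\mathbb P\Big(\big|J_n^{\theta,\xi}-J^*(M_\theta)\big|\ge\tfrac13\Delta_{\mathcal M}(n^{-1/2})\Big)\ge\tfrac14,$$ and $$\inf_{\xi\in\Xi_n}\sup_{\theta\in\Theta}\mathbb E\big|J_n^{\theta,\xi}-J^*(M_\theta)\big|\ge\tfrac1{12}\Delta_{\mathcal M}(n^{-1/2}).$$ -/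

import Mathlib

open MeasureTheory ProbabilityTheory
open scoped ENNReal BoundedContinuousFunction

noncomputable section

namespace RLLowerBound

/-! ### Policies, state-action distributions, total reward

Throughout, `Fin H` is the set of time steps (the step `h` of the usual numbering `1, …, H` is the
element `h - 1` of `Fin H`). -/

/-- A (randomized, Markov) policy `π = (π_h)_h`: for every step, a probability distribution on
actions depending measurably on the state. -/
structure Policy (𝒮 𝒜 : Type*) [MeasurableSpace 𝒮] [MeasurableSpace 𝒜] (H : ℕ) where
  kernel : Fin H → Kernel 𝒮 𝒜
  isMarkov : ∀ h, IsMarkovKernel (kernel h)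

section MDP

variable {𝒮 𝒜 : Type*} [MeasurableSpace 𝒮] [MeasurableSpace 𝒜] {H : ℕ}

/-- `ρ_{h,P,π,μ}`, the law of `(S_h, A_h)` when `S_0 ∼ μ`, `A_h ∼ π_h(· | S_h)` and
`S_{h+1} ∼ P(· | h, S_h, A_h)`. -/
def stateActionLaw (P : Fin H → Kernel (𝒮 × 𝒜) 𝒮) (π : Policy 𝒮 𝒜 H) (μ : Measure 𝒮) :
    (h : ℕ) → h < H → Measure (𝒮 × 𝒜)
  | 0, hh => μ ⊗ₘ π.kernel ⟨0, hh⟩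
  | h + 1, hh =>
      ((stateActionLaw P π μ h (Nat.lt_of_succ_lt hh)).bind
        (P ⟨h, Nat.lt_of_succ_lt hh⟩)) ⊗ₘ π.kernel ⟨h + 1, hh⟩

/-- `Π(h, P, μ)`: the possible distributions of `(S_h, A_h)` over all policies. -/
def reachableAt (P : Fin H → Kernel (𝒮 × 𝒜) 𝒮) (μ : Measure 𝒮) (h : Fin H) :
    Set (Measure (𝒮 × 𝒜)) :=
  {ρ | ∃ π : Policy 𝒮 𝒜 H, ρ = stateActionLaw P π μ h.1 h.2}

/-- `Π(P, μ)`: the union of the sets `Π(h, P, μ)` over all steps `h`. -/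
def reachable (P : Fin H → Kernel (𝒮 × 𝒜) 𝒮) (μ : Measure 𝒮) : Set (Measure (𝒮 × 𝒜)) :=
  ⋃ h : Fin H, reachableAt P μ h

/-- The total expected reward `J(M, π)`. -/
def totalReward (P : Fin H → Kernel (𝒮 × 𝒜) 𝒮) (r : Fin H → 𝒮 × 𝒜 → ℝ) (μ : Measure 𝒮)
    (π : Policy 𝒮 𝒜 H) : ℝ :=
  ∑ h : Fin H, ∫ z, r h z ∂(stateActionLaw P π μ h.1 h.2)

/-- The optimal total reward `J*(M) = sup_π J(M, π)`. -/
def optimalReward (P : Fin H → Kernel (𝒮 × 𝒜) 𝒮) (r : Fin H → 𝒮 × 𝒜 → ℝ) (μ : Measure 𝒮) : ℝ :=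
  ⨆ π : Policy 𝒮 𝒜 H, totalReward P r μ π

end MDP

/-! ### Families of MDPs -/

/-- A family of MDPs `M_θ = (𝒮, 𝒜, P_θ, r_θ, H, μ)`, `θ = (θ_P, θ_r) ∈ Θ_P × Θ_r`, whose rewards
range over all `r` with `r(h, ·, ·)` in the unit ball of a normed space `𝓑` of bounded continuous
functions on `𝒮 × 𝒜`, together with a simulator `p_θ` of the transitions that is driven by a
standard normal variable. -/
structure MDPFamily (𝒮 𝒜 : Type*) [TopologicalSpace 𝒮] [MeasurableSpace 𝒮]
    [TopologicalSpace 𝒜] [MeasurableSpace 𝒜] (H : ℕ)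
    (𝓑 : Type*) [NormedAddCommGroup 𝓑] [NormedSpace ℝ 𝓑] (ΘP Θr : Type*) where
  /-- The inclusion `𝓑 ⊂ C(𝒮 × 𝒜)`. -/
  incl : 𝓑 →ₗ[ℝ] (𝒮 × 𝒜 →ᵇ ℝ)
  incl_injective : Function.Injective incl
  /-- The sup norm is at most a constant times the norm of `𝓑`. -/
  incl_bound : ∃ B : ℝ, 0 < B ∧ ∀ g, ‖incl g‖ ≤ B * ‖g‖
  /-- The initial distribution. -/
  μ : Measure 𝒮
  isProbabilityMeasure_μ : IsProbabilityMeasure μ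
  /-- The transition probabilities `P_θ(· | h, s, a)`. -/
  P : ΘP → Fin H → Kernel (𝒮 × 𝒜) 𝒮
  isMarkov_P : ∀ θ h, IsMarkovKernel (P θ h)
  /-- The expected rewards `r_θ(h, s, a)`. -/
  r : Θr → Fin H → 𝒮 × 𝒜 → ℝ
  range_r : Set.range r = {f | ∀ h, ∃ g : 𝓑, ‖g‖ ≤ 1 ∧ ∀ z, f h z = incl g z}
  /-- The simulator: `p_θ(h, s, a, u) ∼ P_θ(· | h, s, a)` for standard normal `u`. -/
  p : ΘP → Fin H × (𝒮 × 𝒜) × ℝ → 𝒮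
  measurable_p : ∀ θ, Measurable (p θ)
  map_p : ∀ θ h z, (gaussianReal 0 1).map (fun x => p θ (h, z, x)) = P θ h z

/-! ### The sources of randomness -/

/-- Independent standard normal random variables `ε_i`, `u_i` (`i ∈ ℕ`) and `ū` on a common
probability space: `ε_i` is the reward noise and `u_i` the transition noise of the `i`-th sample,
`ū` the internal randomness of the algorithm. -/
structure Noise {Ω : Type*} [MeasurableSpace Ω] (Pr : Measure Ω) where
  ε : ℕ → Ω → ℝ
  u : ℕ → Ω → ℝ
  ubar : Ω → ℝ
  measurable_ε : ∀ i, Measurable (ε i)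
  measurable_u : ∀ i, Measurable (u i)
  measurable_ubar : Measurable ubar
  map_ε : ∀ i, Pr.map (ε i) = gaussianReal 0 1
  map_u : ∀ i, Pr.map (u i) = gaussianReal 0 1
  map_ubar : Pr.map ubar = gaussianReal 0 1
  indep : iIndepFun (Sum.elim ε (Sum.elim u fun _ : Unit => ubar)) Pr

/-! ### Algorithms and sampling schemes -/

/-- One record `(h, s, a, x, y)` of an algorithm: step, state, action, next state, noisy reward. -/
abbrev Record (𝒮 𝒜 : Type*) (H : ℕ) := (Fin H × 𝒮 × 𝒜) × 𝒮 × ℝ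

/-- One record `(h, s, a, x)` of a sampling scheme: step, state, action, next state. -/
abbrev StateRecord (𝒮 𝒜 : Type*) (H : ℕ) := (Fin H × 𝒮 × 𝒜) × 𝒮

/-- The set `Ξ_n` of algorithms `ξ = (f_1, …, f_n, F)` that access the simulator `n` times: the
next query is a measurable function of all earlier records and of `ū`, and the output is a
measurable function of all `n` records and of `ū`. -/
structure Algorithm (𝒮 𝒜 : Type*) [MeasurableSpace 𝒮] [MeasurableSpace 𝒜] (H n : ℕ) where
  query : (i : Fin n) → (Fin i → Record 𝒮 𝒜 H) × ℝ → Fin H × 𝒮 × 𝒜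
  measurable_query : ∀ i, Measurable (query i)
  output : (Fin n → Record 𝒮 𝒜 H) × ℝ → ℝ
  measurable_output : Measurable output

/-- The set of adaptive sampling schemes `(f̄_1, …, f̄_n)` with `n` samples, which see the sampled
next states only. -/
structure SamplingScheme (𝒮 𝒜 : Type*) [MeasurableSpace 𝒮] [MeasurableSpace 𝒜] (H n : ℕ) where
  query : (i : Fin n) → (Fin i → StateRecord 𝒮 𝒜 H) × ℝ → Fin H × 𝒮 × 𝒜
  measurable_query : ∀ i, Measurable (query i)

section Complexity

variable {𝒮 𝒜 : Type*} [TopologicalSpace 𝒮] [MeasurableSpace 𝒮]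
  [TopologicalSpace 𝒜] [MeasurableSpace 𝒜] {H : ℕ}
  {𝓑 : Type*} [NormedAddCommGroup 𝓑] [NormedSpace ℝ 𝓑] {ΘP Θr : Type*}
  {Ω : Type*} [MeasurableSpace Ω] {Pr : Measure Ω}

/-- The data `D_i` collected by the algorithm `ξ` in its first `i` accesses to the simulator of
the MDP `M_θ`. -/
def Algorithm.data {n : ℕ} (ξ : Algorithm 𝒮 𝒜 H n) (M : MDPFamily 𝒮 𝒜 H 𝓑 ΘP Θr) (N : Noise Pr)
    (θ : ΘP × Θr) (ω : Ω) : (i : ℕ) → i ≤ n → (Fin i → Record 𝒮 𝒜 H)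
  | 0, _ => Fin.elim0
  | i + 1, hi =>
      let D : Fin i → Record 𝒮 𝒜 H := Algorithm.data ξ M N θ ω i (Nat.le_of_succ_le hi)
      let q : Fin H × 𝒮 × 𝒜 := ξ.query ⟨i, hi⟩ (D, N.ubar ω)
      Fin.snoc (α := fun _ => Record 𝒮 𝒜 H) D
        (q, M.p θ.1 (q.1, q.2, N.u i ω), M.r θ.2 q.1 q.2 + N.ε i ω)

/-- The estimate `J_n = F(D_n, ū)` that the algorithm `ξ` returns on `M_θ`. -/
def Algorithm.estimate {n : ℕ} (ξ : Algorithm 𝒮 𝒜 H n) (M : MDPFamily 𝒮 𝒜 H 𝓑 ΘP Θr)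
    (N : Noise Pr) (θ : ΘP × Θr) (ω : Ω) : ℝ :=
  ξ.output (ξ.data M N θ ω n le_rfl, N.ubar ω)

/-- The data collected by a sampling scheme in its first `i` accesses. -/
def SamplingScheme.data {n : ℕ} (ξ : SamplingScheme 𝒮 𝒜 H n) (M : MDPFamily 𝒮 𝒜 H 𝓑 ΘP Θr)
    (N : Noise Pr) (θ : ΘP × Θr) (ω : Ω) : (i : ℕ) → i ≤ n → (Fin i → StateRecord 𝒮 𝒜 H)
  | 0, _ => Fin.elim0
  | i + 1, hi =>
      let D : Fin i → StateRecord 𝒮 𝒜 H :=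
        SamplingScheme.data ξ M N θ ω i (Nat.le_of_succ_le hi)
      let q : Fin H × 𝒮 × 𝒜 := ξ.query ⟨i, hi⟩ (D, N.ubar ω)
      Fin.snoc (α := fun _ => StateRecord 𝒮 𝒜 H) D (q, M.p θ.1 (q.1, q.2, N.u i ω))

/-- The state-action pair `(s_i, a_i)` queried by a sampling scheme in its `i`-th access. -/
def SamplingScheme.stateAction {n : ℕ} (ξ : SamplingScheme 𝒮 𝒜 H n)
    (M : MDPFamily 𝒮 𝒜 H 𝓑 ΘP Θr) (N : Noise Pr) (θ : ΘP × Θr) (i : Fin n) (ω : Ω) : 𝒮 × 𝒜 :=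
  (ξ.query i (ξ.data M N θ ω i i.2.le, N.ubar ω)).2

/-- The average law `(1/n) ∑_i Law(s_i, a_i)` of the queried state-action pairs. -/
def SamplingScheme.averageLaw {n : ℕ} (ξ : SamplingScheme 𝒮 𝒜 H n)
    (M : MDPFamily 𝒮 𝒜 H 𝓑 ΘP Θr) (N : Noise Pr) (θ : ΘP × Θr) : Measure (𝒮 × 𝒜) :=
  (n : ℝ≥0∞)⁻¹ • ∑ i : Fin n, Pr.map (ξ.stateAction M N θ i)

/-! ### Perturbation response and perturbational complexity

These are suprema and infima of non-negative numbers; they are taken in `[0, ∞]`. -/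

/-- The `Π`-norm `sup_{ρ ∈ Π} |∫ g dρ|`. -/
def piNorm (Pi : Set (Measure (𝒮 × 𝒜))) (g : 𝒮 × 𝒜 → ℝ) : ℝ≥0∞ :=
  ⨆ ρ ∈ Pi, ENNReal.ofReal |∫ z, g z ∂ρ|

/-- The `ν`-perturbation space with scale `ε`: the `g ∈ 𝓑` with `‖g‖_𝓑 ≤ 1` and
`‖g‖_{L²(ν)} ≤ ε`. -/
def perturbationSpace (M : MDPFamily 𝒮 𝒜 H 𝓑 ΘP Θr) (ε : ℝ) (ν : Measure (𝒮 × 𝒜)) : Set 𝓑 :=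
  {g | ‖g‖ ≤ 1 ∧ eLpNorm (M.incl g) 2 ν ≤ ENNReal.ofReal ε}

/-- The perturbation response by distribution mismatch `R(Π, 𝓑, ε, ν)`. -/
def perturbationResponse (M : MDPFamily 𝒮 𝒜 H 𝓑 ΘP Θr) (Pi : Set (Measure (𝒮 × 𝒜))) (ε : ℝ)
    (ν : Measure (𝒮 × 𝒜)) : ℝ≥0∞ :=
  ⨆ g ∈ perturbationSpace M ε ν, piNorm Pi (M.incl g)

/-- The perturbational complexity by distribution mismatch `Δ_M(ε)` for unknown transitions, with
`⌊1/ε²⌋` samples. -/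
def perturbationalComplexity (M : MDPFamily 𝒮 𝒜 H 𝓑 ΘP Θr) (N : Noise Pr) (ε : ℝ) : ℝ≥0∞ :=
  ⨅ ξ : SamplingScheme 𝒮 𝒜 H ⌊1 / ε ^ 2⌋₊, ⨆ θ : ΘP × Θr,
    perturbationResponse M (reachable (M.P θ.1) M.μ) ε (ξ.averageLaw M N θ)

/-- The optimal total reward `J*(M_θ)`. -/
def MDPFamily.optimalValue (M : MDPFamily 𝒮 𝒜 H 𝓑 ΘP Θr) (θ : ΘP × Θr) : ℝ :=
  optimalReward (M.P θ.1) (M.r θ.2) M.μ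

end Complexity

end RLLowerBound

end

open RLLowerBound

/-! This is a two-point argument. Fix an algorithm `ξ` and run it with zero mean rewards. The
observed rewards are then pure noise, so a sampling scheme that sees only next states can imitate
the run by simulating that noise from its own randomness: a single Gaussian variable can be mapped
to any law on a standard Borel space (`Algorithm.exists_scheme`). The scheme's average query law `ν`
is therefore the one of `ξ` under zero rewards.

Let `Δ` be the complexity at scale `n^(-1/2)`. As `Δ` is an infimum over schemes, if it is positive
there are a transition parameter, a step, a policy and a `g` in the unit ball with `‖g‖_{L²(ν)} ≤
n^(-1/2)` and `∫ g dρ > 2Δ/3`, after a change of sign if necessary. Compare zero rewards with the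
reward that is `g` at that step and zero elsewhere. The optimal values are `0` and more than `2Δ/3`,
so an estimate cannot be within `Δ/3` of both.

The data laws are close. The likelihood ratio is a product of Gaussian factors
(`Algorithm.lintegral_data_eq`), and the divergence of the zero-reward law from the other is half
the expected sum of squared mean rewards at the queries (`Algorithm.integral_logLik_data`), hence at
most `n · n⁻¹ / 2 = 1/2`. The expectation is taken under zero rewards, exactly where `ν` is defined.
A divergence of at most `1/2` forces error probability `1/4` in one of the two models
(`one_fourth_le_or_of_neg_half_le_integral`). Markov's inequality gives the bound in expectation. -/

noncomputable section

namespace RLLowerBound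

/-! ### Simulating arbitrary laws from one real variable; independence of blocks of noise -/

section Simulation

open Set Filter Topology unitInterval

/-- The distribution function of an atomless probability measure on `ℝ` is continuous. -/
theorem continuous_cdf (γ : Measure ℝ) [IsProbabilityMeasure γ] (hγ : ∀ x, γ {x} = 0) :
    Continuous (cdf γ) := by
  refine continuous_iff_continuousAt.2 fun x => ?_
  rw [(monotone_cdf γ).continuousAt_iff_leftLim_eq_rightLim, (cdf γ).rightLim_eq]
  have h := hγ x
  -- The mass of a point is the jump of the distribution function there.
  rw [← measure_cdf γ, StieltjesFunction.measure_singleton, ENNReal.ofReal_eq_zero] at h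
  exact le_antisymm ((monotone_cdf γ).leftLim_le le_rfl) (by linarith)

/-- The probability integral transform of an atomless probability measure on `ℝ`. -/
theorem map_cdf (γ : Measure ℝ) [IsProbabilityMeasure γ] (hγ : ∀ x, γ {x} = 0) :
    γ.map (cdf γ) = (volume : Measure ℝ).restrict (Icc 0 1) := by
  have hc := continuous_cdf γ hγ
  have hm : Measurable (cdf γ) := hc.measurable
  have key : ∀ t ∈ Ioo (0 : ℝ) 1, ∃ x, cdf γ x = t := fun t ht => by
    obtain ⟨a, ha⟩ := ((tendsto_cdf_atBot γ).eventually_lt_const ht.1).exists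
    obtain ⟨b, hb⟩ := ((tendsto_cdf_atTop γ).eventually_const_lt ht.2).exists
    exact mem_range_of_exists_le_of_exists_ge hc ⟨a, ha.le⟩ ⟨b, hb.le⟩
  -- The slack `δ` is needed because the distribution function may be flat at level `t`, or may not
  -- attain `0`; a point at level `t + δ` lies to the right of the whole sublevel set.
  have upper : ∀ t, 0 ≤ t → γ {x | cdf γ x ≤ t} ≤ ENNReal.ofReal t := fun t ht => by
    refine ENNReal.le_of_forall_pos_le_add fun δ hδ _ => ?_
    have hδ' : (0 : ℝ) < δ := hδ
    rcases le_or_gt 1 (t + δ) with h1 | h1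
    · calc γ {x | cdf γ x ≤ t} ≤ 1 := prob_le_one
        _ ≤ ENNReal.ofReal (t + δ) := by simpa using ENNReal.ofReal_le_ofReal h1
        _ = _ := by rw [ENNReal.ofReal_add ht hδ'.le, ENNReal.ofReal_coe_nnreal]
    · obtain ⟨x, hx⟩ := key (t + δ) ⟨by linarith, h1⟩
      calc γ {x | cdf γ x ≤ t} ≤ γ (Iic x) := measure_mono fun y (hy : cdf γ y ≤ t) => by
            by_contra hxy
            have := monotone_cdf γ (not_le.1 hxy).le
            linarith
        _ = ENNReal.ofReal (t + δ) := by rw [← ofReal_cdf, hx]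
        _ = _ := by rw [ENNReal.ofReal_add ht hδ'.le, ENNReal.ofReal_coe_nnreal]
  have hfin : IsFiniteMeasure ((volume : Measure ℝ).restrict (Icc 0 1)) := ⟨by simp⟩
  refine Measure.ext_of_Iic _ _ fun t => ?_
  rw [Measure.map_apply hm measurableSet_Iic, Measure.restrict_apply measurableSet_Iic]
  change γ {x | cdf γ x ≤ t} = _
  rcases lt_or_ge t 0 with ht | ht
  · have h1 : {x | cdf γ x ≤ t} = ∅ := by
      ext x; simpa using ht.trans_le (cdf_nonneg γ x)
    have h2 : Iic t ∩ Icc (0 : ℝ) 1 = ∅ := by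
      ext x; simp only [mem_inter_iff, mem_Iic, mem_Icc, mem_empty_iff_false]; grind
    rw [h1, h2]; simp
  rcases le_or_gt 1 t with ht1 | ht1
  · have h1 : {x | cdf γ x ≤ t} = univ := by
      ext x; simpa using (cdf_le_one γ x).trans ht1
    have h2 : Iic t ∩ Icc (0 : ℝ) 1 = Icc 0 1 :=
      inter_eq_right.2 fun x hx => hx.2.trans ht1
    rw [h1, h2]; simp
  · have h2 : Iic t ∩ Icc (0 : ℝ) 1 = Icc 0 t := by
      ext x; simp only [mem_inter_iff, mem_Iic, mem_Icc]; grind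
    rw [h2, Real.volume_Icc, sub_zero]
    refine le_antisymm (upper t ht) ?_
    rcases ht.eq_or_lt with rfl | ht0
    · simp
    · obtain ⟨x, hx⟩ := key t ⟨ht0, ht1⟩
      rw [← hx, ofReal_cdf]
      exact measure_mono fun y (hy : y ≤ x) => monotone_cdf γ hy

/-- Every probability measure on a standard Borel space is the image of an atomless probability
measure on `ℝ`. -/
theorem exists_measurable_map_eq_of_atomless (γ : Measure ℝ) [IsProbabilityMeasure γ]
    (hγ : ∀ x, γ {x} = 0) {Y : Type*} [MeasurableSpace Y] [StandardBorelSpace Y] [Nonempty Y]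
    (K : Measure Y) [IsProbabilityMeasure K] :
    ∃ f : ℝ → Y, Measurable f ∧ γ.map f = K := by
  -- This `f` transports the uniform law on the unit interval to `K`; the distribution function
  -- supplies the uniform variable, and `projIcc` only changes its codomain.
  obtain ⟨f, hf, hfK⟩ := K.exists_measurable_map_eq
  have hp : Measurable (projIcc (0 : ℝ) 1 zero_le_one) := continuous_projIcc.measurable
  have hc : Measurable (cdf γ) := (continuous_cdf γ hγ).measurable
  have hI : ((volume : Measure ℝ).restrict (Icc 0 1)).map (projIcc (0 : ℝ) 1 zero_le_one)
      = (volume : Measure I) := by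
    have h1 : (volume : Measure I).map Subtype.val = (volume : Measure ℝ).restrict (Icc 0 1) :=
      map_comap_subtype_coe measurableSet_Icc _
    rw [← h1, Measure.map_map hp measurable_subtype_coe]
    have : projIcc (0 : ℝ) 1 zero_le_one ∘ Subtype.val = id := by
      ext x; simp
    rw [this, Measure.map_id]
  refine ⟨f ∘ projIcc (0 : ℝ) 1 zero_le_one ∘ cdf γ, by fun_prop, ?_⟩
  rw [← Measure.map_map hf (hp.comp hc), ← Measure.map_map hp hc, map_cdf γ hγ, hI, hfK]

/-- Two random variables that are measurable with respect to disjoint subfamilies of an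
independent family are independent. -/
theorem iIndepFun_indepFun_of_measurable_iSup {Ω ι : Type*} {β : ι → Type*}
    {mΩ : MeasurableSpace Ω} {Pr : Measure Ω} {mβ : ∀ i, MeasurableSpace (β i)}
    {f : ∀ i, Ω → β i} (hf : ∀ i, Measurable (f i)) (hi : iIndepFun f Pr)
    {S T : Set ι} (hST : Disjoint S T) {γ δ : Type*} [MeasurableSpace γ] [MeasurableSpace δ]
    {X : Ω → γ} {Y : Ω → δ}
    (hX : Measurable[⨆ i ∈ S, MeasurableSpace.comap (f i) (mβ i)] X)
    (hY : Measurable[⨆ i ∈ T, MeasurableSpace.comap (f i) (mβ i)] Y) :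
    IndepFun X Y Pr := by
  have h := indep_iSup_of_disjoint (fun i => (hf i).comap_le) hi hST
  rw [IndepFun_iff_Indep]
  exact indep_of_indep_of_le_right (indep_of_indep_of_le_left h hX.comap_le) hY.comap_le

theorem measurable_iSup_comap {Ω ι : Type*} {β : ι → Type*}
    {mβ : ∀ i, MeasurableSpace (β i)} (f : ∀ i, Ω → β i) {S : Set ι} {i : ι} (hi : i ∈ S) :
    Measurable[⨆ i ∈ S, MeasurableSpace.comap (f i) (mβ i)] (f i) :=
  Measurable.mono (comap_measurable (f i)) (le_iSup₂_of_le i hi le_rfl) le_rfl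

end Simulation

/-! ### Runs as functions of the noise, and imitation of an algorithm by a sampling scheme -/

section Runs

theorem measurable_snoc {X : Type*} [MeasurableSpace X] (i : ℕ) :
    Measurable fun p : (Fin i → X) × X => (Fin.snoc (α := fun _ => X) p.1 p.2 : Fin (i + 1) → X) := by
  refine measurable_pi_iff.2 fun j => ?_
  refine Fin.lastCases ?_ (fun j => ?_) j
  · simpa using measurable_snd
  · simp only [Fin.snoc_castSucc]
    exact (measurable_pi_apply j).comp measurable_fst

/-- Complete the records of a sampling scheme by simulated rewards. -/
def attachRewards {𝒮 𝒜 : Type*} {H i : ℕ} (d : Fin i → StateRecord 𝒮 𝒜 H) (e : ℕ → ℝ) :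
    Fin i → Record 𝒮 𝒜 H := fun j => ((d j).1, (d j).2, e j)

theorem measurable_attachRewards {𝒮 𝒜 : Type*} [MeasurableSpace 𝒮] [MeasurableSpace 𝒜] {H i : ℕ} :
    Measurable fun p : (Fin i → StateRecord 𝒮 𝒜 H) × (ℕ → ℝ) => attachRewards p.1 p.2 := by
  refine measurable_pi_iff.2 fun j => ?_
  have h : Measurable fun p : (Fin i → StateRecord 𝒮 𝒜 H) × (ℕ → ℝ) => p.1 j :=
    (measurable_pi_apply j).comp measurable_fst
  exact h.fst.prodMk (h.snd.prodMk ((measurable_pi_apply (j : ℕ)).comp measurable_snd))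

variable {𝒮 𝒜 : Type*} [TopologicalSpace 𝒮] [MeasurableSpace 𝒮]
  [TopologicalSpace 𝒜] [MeasurableSpace 𝒜] {H : ℕ}
  {𝓑 : Type*} [NormedAddCommGroup 𝓑] [NormedSpace ℝ 𝓑] {ΘP Θr : Type*}
  {Ω : Type*} [mΩ : MeasurableSpace Ω] {Pr : Measure Ω} {n : ℕ}

theorem MDPFamily.measurable_r [OpensMeasurableSpace (𝒮 × 𝒜)] (M : MDPFamily 𝒮 𝒜 H 𝓑 ΘP Θr)
    (θ : Θr) : Measurable fun q : Fin H × 𝒮 × 𝒜 => M.r θ q.1 q.2 := by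
  refine measurable_from_prod_countable_right fun h => ?_
  have : M.r θ ∈ Set.range M.r := ⟨θ, rfl⟩
  rw [M.range_r] at this
  obtain ⟨g, -, hg⟩ := this h
  have h' : (fun z => M.r θ h z) = M.incl g := funext hg
  change Measurable fun z => M.r θ h z
  rw [h']
  exact (M.incl g).continuous.measurable

/-- One access to the simulator: from the data collected so far and the internal randomness,
together with fresh transition and reward noise, to the extended data. -/
def Algorithm.step (ξ : Algorithm 𝒮 𝒜 H n) (M : MDPFamily 𝒮 𝒜 H 𝓑 ΘP Θr) (θ : ΘP × Θr)
    (i : Fin n) (x : ((Fin i → Record 𝒮 𝒜 H) × ℝ) × ℝ × ℝ) : Fin (i + 1) → Record 𝒮 𝒜 H :=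
  Fin.snoc (α := fun _ => Record 𝒮 𝒜 H) x.1.1
    (ξ.query i x.1, M.p θ.1 ((ξ.query i x.1).1, (ξ.query i x.1).2, x.2.1),
      M.r θ.2 (ξ.query i x.1).1 (ξ.query i x.1).2 + x.2.2)

theorem Algorithm.data_succ (ξ : Algorithm 𝒮 𝒜 H n) (M : MDPFamily 𝒮 𝒜 H 𝓑 ΘP Θr)
    (N : Noise Pr) (θ : ΘP × Θr) (ω : Ω) (i : ℕ) (hi : i + 1 ≤ n) :
    ξ.data M N θ ω (i + 1) hi
      = ξ.step M θ ⟨i, hi⟩ ((ξ.data M N θ ω i (Nat.le_of_succ_le hi), N.ubar ω),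
          N.u i ω, N.ε i ω) := rfl

theorem Algorithm.measurable_step [OpensMeasurableSpace (𝒮 × 𝒜)] (ξ : Algorithm 𝒮 𝒜 H n)
    (M : MDPFamily 𝒮 𝒜 H 𝓑 ΘP Θr) (θ : ΘP × Θr) (i : Fin n) : Measurable (ξ.step M θ i) := by
  have hq : Measurable fun x : ((Fin i → Record 𝒮 𝒜 H) × ℝ) × ℝ × ℝ => ξ.query i x.1 :=
    (ξ.measurable_query i).comp measurable_fst
  have hr := (M.measurable_r θ.2).comp hq
  have hp := (M.measurable_p θ.1).comp
    (hq.fst.prodMk (hq.snd.prodMk (measurable_fst.comp measurable_snd)))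
  exact (measurable_snoc i).comp ((measurable_fst.comp measurable_fst).prodMk
    (hq.prodMk (hp.prodMk (hr.add (measurable_snd.comp measurable_snd)))))

/-- The data as a function of the internal randomness and the reward noise on the one hand and of
the transition noise on the other hand. -/
def Algorithm.run (ξ : Algorithm 𝒮 𝒜 H n) (M : MDPFamily 𝒮 𝒜 H 𝓑 ΘP Θr) (θ : ΘP × Θr)
    (w : (ℝ × (ℕ → ℝ)) × (ℕ → ℝ)) : (i : ℕ) → i ≤ n → (Fin i → Record 𝒮 𝒜 H)
  | 0, _ => Fin.elim0
  | i + 1, hi => ξ.step M θ ⟨i, hi⟩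
      ((Algorithm.run ξ M θ w i (Nat.le_of_succ_le hi), w.1.1), w.2 i, w.1.2 i)

/-- The data are measurable with respect to the noise used so far. -/
theorem Algorithm.measurable_run_of [OpensMeasurableSpace (𝒮 × 𝒜)] (ξ : Algorithm 𝒮 𝒜 H n)
    (M : MDPFamily 𝒮 𝒜 H 𝓑 ΘP Θr) (θ : ΘP × Θr) {Ω' : Type*} {m : MeasurableSpace Ω'}
    {w : Ω' → (ℝ × (ℕ → ℝ)) × (ℕ → ℝ)} (i : ℕ) (hi : i ≤ n)
    (hubar : Measurable fun ω => (w ω).1.1) (hu : ∀ j < i, Measurable fun ω => (w ω).2 j)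
    (hε : ∀ j < i, Measurable fun ω => (w ω).1.2 j) :
    Measurable fun ω => ξ.run M θ (w ω) i hi := by
  induction i with
  | zero => exact measurable_pi_iff.2 fun j => j.elim0
  | succ i ih =>
    have h := ih (Nat.le_of_succ_le hi) (fun j hj => hu j (hj.trans i.lt_succ_self))
      (fun j hj => hε j (hj.trans i.lt_succ_self))
    exact (ξ.measurable_step M θ ⟨i, hi⟩).comp ((h.prodMk hubar).prodMk
      ((hu i i.lt_succ_self).prodMk (hε i i.lt_succ_self)))

/-- Detaching the run from `Ω` allows the same map to be fed with simulated noise in place of the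
true noise. -/
theorem Algorithm.data_eq_run (ξ : Algorithm 𝒮 𝒜 H n) (M : MDPFamily 𝒮 𝒜 H 𝓑 ΘP Θr)
    (N : Noise Pr) (θ : ΘP × Θr) (ω : Ω) (i : ℕ) (hi : i ≤ n) :
    ξ.data M N θ ω i hi = ξ.run M θ ((N.ubar ω, fun j => N.ε j ω), fun j => N.u j ω) i hi := by
  induction i with
  | zero => rfl
  | succ i ih => rw [Algorithm.data_succ, ih]; rfl

theorem Algorithm.measurable_data [OpensMeasurableSpace (𝒮 × 𝒜)] (ξ : Algorithm 𝒮 𝒜 H n)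
    (M : MDPFamily 𝒮 𝒜 H 𝓑 ΘP Θr) (N : Noise Pr) (θ : ΘP × Θr) (i : ℕ) (hi : i ≤ n) :
    Measurable fun ω => ξ.data M N θ ω i hi := by
  simp only [Algorithm.data_eq_run]
  exact ξ.measurable_run_of M θ i hi N.measurable_ubar (fun j _ => N.measurable_u j)
    fun j _ => N.measurable_ε j

theorem Noise.measurable_sumElim (N : Noise Pr) :
    ∀ k, Measurable ((Sum.elim N.ε (Sum.elim N.u fun _ : Unit => N.ubar) : _ → Ω → ℝ) k) := by
  rintro (j | j | j)
  exacts [N.measurable_ε j, N.measurable_u j, N.measurable_ubar]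

/-- The data collected before the `i`-th access are independent of the noise of that access. -/
theorem Algorithm.indepFun_data_noise [OpensMeasurableSpace (𝒮 × 𝒜)] (ξ : Algorithm 𝒮 𝒜 H n)
    (M : MDPFamily 𝒮 𝒜 H 𝓑 ΘP Θr) (N : Noise Pr) (θ : ΘP × Θr) (i : ℕ) (hi : i ≤ n) :
    IndepFun (fun ω => (ξ.data M N θ ω i hi, N.ubar ω)) (fun ω => (N.u i ω, N.ε i ω)) Pr := by
  have hm := N.measurable_sumElim
  -- `S` indexes the noise used before access `i`, together with `ū`; `T` indexes the fresh noise of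
  -- access `i`.
  let S : Set (ℕ ⊕ ℕ ⊕ Unit) :=
    {k | Sum.elim (fun j => j < i) (Sum.elim (fun j => j < i) fun _ => True) k}
  let T : Set (ℕ ⊕ ℕ ⊕ Unit) := {Sum.inl i, Sum.inr (Sum.inl i)}
  have hST : Disjoint S T := by
    rw [Set.disjoint_left]
    rintro (j | j | j) hj <;> simp_all [S, T] <;> omega
  refine iIndepFun_indepFun_of_measurable_iSup hm N.indep hST ?_ ?_
  · have hb := measurable_iSup_comap (mβ := fun _ => inferInstance)
      (Sum.elim N.ε (Sum.elim N.u fun _ : Unit => N.ubar) : _ → Ω → ℝ)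
      (S := S) (i := Sum.inr (Sum.inr ())) (by simp [S])
    simp only [Algorithm.data_eq_run]
    refine Measurable.prodMk (ξ.measurable_run_of M θ i hi hb (fun j hj => ?_)
      fun j hj => ?_) hb
    · exact measurable_iSup_comap (mβ := fun _ => inferInstance)
        (Sum.elim N.ε (Sum.elim N.u fun _ : Unit => N.ubar) : _ → Ω → ℝ)
        (S := S) (i := Sum.inr (Sum.inl j)) (by simpa [S] using hj)
    · exact measurable_iSup_comap (mβ := fun _ => inferInstance)
        (Sum.elim N.ε (Sum.elim N.u fun _ : Unit => N.ubar) : _ → Ω → ℝ)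
        (S := S) (i := Sum.inl j) (by simpa [S] using hj)
  · exact Measurable.prodMk
      (measurable_iSup_comap (mβ := fun _ => inferInstance)
        (Sum.elim N.ε (Sum.elim N.u fun _ : Unit => N.ubar) : _ → Ω → ℝ)
        (S := T) (i := Sum.inr (Sum.inl i)) (by simp [T]))
      (measurable_iSup_comap (mβ := fun _ => inferInstance)
        (Sum.elim N.ε (Sum.elim N.u fun _ : Unit => N.ubar) : _ → Ω → ℝ)
        (S := T) (i := Sum.inl i) (by simp [T]))

/-- The product form lets Fubini integrate out the fresh noise with the past held fixed, which
drives the change of measure. -/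
theorem Algorithm.map_data_noise [OpensMeasurableSpace (𝒮 × 𝒜)] [IsProbabilityMeasure Pr]
    (ξ : Algorithm 𝒮 𝒜 H n) (M : MDPFamily 𝒮 𝒜 H 𝓑 ΘP Θr) (N : Noise Pr) (θ : ΘP × Θr)
    (i : ℕ) (hi : i ≤ n) :
    Pr.map (fun ω => ((ξ.data M N θ ω i hi, N.ubar ω), N.u i ω, N.ε i ω))
      = (Pr.map fun ω => (ξ.data M N θ ω i hi, N.ubar ω)).prod
          ((gaussianReal 0 1).prod (gaussianReal 0 1)) := by
  have hD := (ξ.measurable_data M N θ i hi).prodMk N.measurable_ubar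
  have h1 : IndepFun (N.u i) (N.ε i) Pr :=
    N.indep.indepFun (i := Sum.inr (Sum.inl i)) (j := Sum.inl i) (by simp)
  have h2 := h1.map_prod_eq_prod_map_map (N.measurable_u i).aemeasurable
    (N.measurable_ε i).aemeasurable
  rw [N.map_u, N.map_ε] at h2
  rw [← h2]
  refine IndepFun.map_prod_eq_prod_map_map hD.aemeasurable
    ((N.measurable_u i).prodMk (N.measurable_ε i)).aemeasurable (ξ.indepFun_data_noise M N θ i hi)

/-- The sampling scheme that runs an algorithm on pure noise rewards, where the internal randomness
of the algorithm and the reward noise are simulated by means of `φ`. -/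
def Algorithm.toScheme (ξ : Algorithm 𝒮 𝒜 H n) (φ : ℝ → ℝ × (ℕ → ℝ)) (hφ : Measurable φ) :
    SamplingScheme 𝒮 𝒜 H n where
  query i x := ξ.query i (attachRewards x.1 (φ x.2).2, (φ x.2).1)
  measurable_query i := by
    have h : Measurable fun x : (Fin i → StateRecord 𝒮 𝒜 H) × ℝ => φ x.2 := hφ.comp measurable_snd
    exact (ξ.measurable_query i).comp
      ((measurable_attachRewards.comp (measurable_fst.prodMk h.snd)).prodMk h.fst)

/-- With zero mean rewards each observed reward equals its noise, so the rewards filled in by the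
scheme are those that the algorithm would have seen had the simulated noise been real. -/
theorem Algorithm.attachRewards_toScheme_data (ξ : Algorithm 𝒮 𝒜 H n) (φ : ℝ → ℝ × (ℕ → ℝ))
    (hφ : Measurable φ) (M : MDPFamily 𝒮 𝒜 H 𝓑 ΘP Θr) (N : Noise Pr) {θ₀ : Θr}
    (h₀ : M.r θ₀ = 0) (θ : ΘP × Θr) (ω : Ω) (i : ℕ) (hi : i ≤ n) :
    attachRewards ((ξ.toScheme φ hφ).data M N θ ω i hi) (φ (N.ubar ω)).2
      = ξ.run M (θ.1, θ₀) (φ (N.ubar ω), fun j => N.u j ω) i hi := by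
  induction i with
  | zero => funext j; exact j.elim0
  | succ i ih =>
    rw [Algorithm.run, ← ih (Nat.le_of_succ_le hi)]
    funext j
    refine Fin.lastCases ?_ (fun j => ?_) j
    · simp [attachRewards, SamplingScheme.data, Algorithm.step, Algorithm.toScheme, h₀]
    · simp [attachRewards, SamplingScheme.data, Algorithm.step]

/-- The law of the state-action pairs queried by an algorithm under zero rewards is the law of the
state-action pairs queried by some sampling scheme. -/
theorem Algorithm.exists_scheme [OpensMeasurableSpace (𝒮 × 𝒜)] [IsProbabilityMeasure Pr]
    (ξ : Algorithm 𝒮 𝒜 H n) (M : MDPFamily 𝒮 𝒜 H 𝓑 ΘP Θr) (N : Noise Pr) {θ₀ : Θr}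
    (h₀ : M.r θ₀ = 0) :
    ∃ ξ' : SamplingScheme 𝒮 𝒜 H n, ∀ θ : ΘP × Θr, ξ'.averageLaw M N θ = (n : ℝ≥0∞)⁻¹ •
      ∑ i : Fin n, Pr.map fun ω =>
        (ξ.query i (ξ.data M N (θ.1, θ₀) ω i i.2.le, N.ubar ω)).2 := by
  have hm := N.measurable_sumElim
  have hεm : Measurable fun ω => (N.ubar ω, fun j => N.ε j ω) :=
    N.measurable_ubar.prodMk (measurable_pi_iff.2 N.measurable_ε)
  have hum : Measurable fun ω => fun j => N.u j ω := measurable_pi_iff.2 N.measurable_u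
  have hK := Measure.isProbabilityMeasure_map (μ := Pr) hεm.aemeasurable
  have hφu : ∀ φ : ℝ → ℝ × (ℕ → ℝ), Measurable φ → Measurable fun ω => φ (N.ubar ω) :=
    fun φ hφ => hφ.comp N.measurable_ubar
  have hatom := nullSingletonClass_gaussianReal (μ := 0) (v := 1) one_ne_zero
  -- One Gaussian variable is turned into a copy of `ū` together with the whole sequence of reward
  -- noises.
  obtain ⟨φ, hφ, hφK⟩ := exists_measurable_map_eq_of_atomless (gaussianReal 0 1)
    (fun x => measure_singleton x) (Pr.map fun ω => (N.ubar ω, fun j => N.ε j ω))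
  let T : Set (ℕ ⊕ ℕ ⊕ Unit) := Set.range fun j => Sum.inr (Sum.inl j)
  have hsup : ∀ (S : Set (ℕ ⊕ ℕ ⊕ Unit)) (k), k ∈ S → _ := fun S k hk =>
    measurable_iSup_comap (mβ := fun _ => inferInstance)
      (Sum.elim N.ε (Sum.elim N.u fun _ : Unit => N.ubar) : _ → Ω → ℝ) (S := S) (i := k) hk
  have hind : IndepFun (fun ω => (N.ubar ω, fun j => N.ε j ω)) (fun ω => fun j => N.u j ω) Pr := by
    refine iIndepFun_indepFun_of_measurable_iSup hm N.indep (S := Tᶜ) (T := T)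
      disjoint_compl_left ?_ ?_
    · exact Measurable.prodMk (hsup Tᶜ (Sum.inr (Sum.inr ())) (by simp [T]))
        ((@measurable_pi_iff _ _ _ (_) _ _).2 fun j => hsup Tᶜ (Sum.inl j) (by simp [T]))
    · exact (@measurable_pi_iff _ _ _ (_) _ _).2 fun j => hsup T (Sum.inr (Sum.inl j)) (by simp [T])
  -- Simulated and true noise have the same law jointly with the transition noise, since both are
  -- independent of it.
  have hlaw : Pr.map (fun ω => (φ (N.ubar ω), fun j => N.u j ω))
      = Pr.map (fun ω => ((N.ubar ω, fun j => N.ε j ω), fun j => N.u j ω)) := by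
    have h2 : IndepFun (fun ω => φ (N.ubar ω)) (fun ω => fun j => N.u j ω) Pr :=
      hind.comp (hφ.comp measurable_fst) measurable_id
    rw [hind.map_prod_eq_prod_map_map hεm.aemeasurable hum.aemeasurable,
      h2.map_prod_eq_prod_map_map (hφu φ hφ).aemeasurable hum.aemeasurable]
    have := Measure.map_map (μ := Pr) hφ N.measurable_ubar
    rw [N.map_ubar, hφK] at this
    rw [this]; rfl
  refine ⟨ξ.toScheme φ hφ, fun θ => ?_⟩
  rw [SamplingScheme.averageLaw]
  congr 1
  refine Finset.sum_congr rfl fun i _ => ?_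
  -- Both queried pairs are this one function, applied to inputs of equal law.
  let G : (ℝ × (ℕ → ℝ)) × (ℕ → ℝ) → 𝒮 × 𝒜 := fun w =>
    (ξ.query i (ξ.run M (θ.1, θ₀) w i i.2.le, w.1.1)).2
  have hG : Measurable G := ((ξ.measurable_query i).comp
    ((ξ.measurable_run_of M (θ.1, θ₀) i i.2.le (by fun_prop) (fun j _ => by fun_prop)
      fun j _ => by fun_prop).prodMk (by fun_prop))).snd
  have e1 : (ξ.toScheme φ hφ).stateAction M N θ i
      = G ∘ fun ω => (φ (N.ubar ω), fun j => N.u j ω) := by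
    funext ω
    simp only [SamplingScheme.stateAction, Algorithm.toScheme, Function.comp_apply, G]
    rw [← ξ.attachRewards_toScheme_data φ hφ M N h₀ θ ω i i.2.le]
    rfl
  have e2 : (fun ω => (ξ.query i (ξ.data M N (θ.1, θ₀) ω i i.2.le, N.ubar ω)).2)
      = G ∘ fun ω => ((N.ubar ω, fun j => N.ε j ω), fun j => N.u j ω) := by
    funext ω
    simp only [Algorithm.data_eq_run, Function.comp_apply, G]
  rw [e1, e2, ← Measure.map_map hG ((hφu φ hφ).prodMk hum), hlaw,
    Measure.map_map hG (hεm.prodMk hum)]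

end Runs

/-! ### Gaussian shifts and a two-point testing bound -/

theorem lintegral_gaussianReal_const_add (c : ℝ) {f : ℝ → ℝ≥0∞} (hf : Measurable f) :
    ∫⁻ e, f (c + e) ∂gaussianReal 0 1
      = ∫⁻ e, f e * ENNReal.ofReal (Real.exp (c * e - c ^ 2 / 2)) ∂gaussianReal 0 1 := by
  -- The shifted noise is normal with mean `c`; the factor `exp (c e - c² / 2)` is the ratio of the
  -- two densities.
  have h1 : ∫⁻ e, f (c + e) ∂gaussianReal 0 1 = ∫⁻ e, f e ∂gaussianReal c 1 := by
    rw [← lintegral_map hf (measurable_const_add c), gaussianReal_map_const_add, zero_add]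
  rw [h1, gaussianReal_of_var_ne_zero _ one_ne_zero, gaussianReal_of_var_ne_zero _ one_ne_zero,
    lintegral_withDensity_eq_lintegral_mul _ (measurable_gaussianPDF _ _) hf,
    lintegral_withDensity_eq_lintegral_mul _ (measurable_gaussianPDF _ _) (by fun_prop)]
  refine lintegral_congr fun e => ?_
  have h2 : gaussianPDF c 1 e
      = gaussianPDF 0 1 e * ENNReal.ofReal (Real.exp (c * e - c ^ 2 / 2)) := by
    rw [gaussianPDF, gaussianPDF, ← ENNReal.ofReal_mul (gaussianPDFReal_nonneg _ _ _),
      gaussianPDFReal, gaussianPDFReal, mul_assoc _ (Real.exp _) (Real.exp _), ← Real.exp_add]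
    congr 3
    simp only [NNReal.coe_one]
    ring
  simp only [Pi.mul_apply, h2]
  ring

/-- A test between two probability measures, the second of density `exp ℓ` with respect to the
first, errs with probability at least `1/4` under one of them if the Kullback-Leibler divergence
`-∫ ℓ` is at most `1/2`. -/
theorem one_fourth_le_or_of_neg_half_le_integral {Ω : Type*} [MeasurableSpace Ω]
    (μ : Measure Ω) [IsProbabilityMeasure μ] {ℓ : Ω → ℝ} (hℓ : Integrable ℓ μ)
    (hexp : ∫⁻ x, ENNReal.ofReal (Real.exp (ℓ x)) ∂μ = 1) (hint : -(1 / 2) ≤ ∫ x, ℓ x ∂μ)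
    {A : Set Ω} (hA : MeasurableSet A) :
    1 / 4 ≤ μ Aᶜ ∨ 1 / 4 ≤ ∫⁻ x in A, ENNReal.ofReal (Real.exp (ℓ x)) ∂μ := by
  by_contra! hcon
  obtain ⟨h1, h2⟩ := hcon
  have hLm : AEStronglyMeasurable (fun x => Real.exp (ℓ x)) μ :=
    Real.continuous_exp.comp_aestronglyMeasurable hℓ.1
  have hnn : ∀ (ν : Measure Ω), 0 ≤ᵐ[ν] fun x => Real.exp (ℓ x) := fun ν =>
    Filter.Eventually.of_forall fun x => (Real.exp_pos _).le
  have hL : Integrable (fun x => Real.exp (ℓ x)) μ := by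
    refine ⟨hLm, ?_⟩
    rw [hasFiniteIntegral_iff_ofReal (hnn μ), hexp]
    exact ENNReal.one_lt_top
  have hL1 : ∫ x, Real.exp (ℓ x) ∂μ = 1 := by
    rw [integral_eq_lintegral_of_nonneg_ae (hnn μ) hLm, hexp, ENNReal.toReal_one]
  have hquarter : (1 / 4 : ℝ≥0∞) = ENNReal.ofReal (1 / 4) := by
    rw [ENNReal.ofReal_div_of_pos (by norm_num)]; simp
  have hp : ∫ x in A, Real.exp (ℓ x) ∂μ < 1 / 4 := by
    rw [integral_eq_lintegral_of_nonneg_ae (hnn _) hLm.restrict]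
    rw [hquarter] at h2
    exact ENNReal.toReal_lt_of_lt_ofReal h2
  have hq : μ.real Aᶜ < 1 / 4 := by
    rw [hquarter] at h1
    exact ENNReal.toReal_lt_of_lt_ofReal h1
  have hA1 : μ.real A = 1 - μ.real Aᶜ := by
    rw [probReal_compl_eq_one_sub hA]; ring
  -- If both errors equalled `1/4`, the divergence between the two outcomes of the test would be
  -- `(log 3) / 2`, which exceeds `1/2`.
  have hlog : 1 < Real.log 3 := by
    rw [Real.lt_log_iff_exp_lt (by norm_num)]
    exact Real.exp_one_lt_d9.trans (by norm_num)
  have hsplit := integral_add_compl hA hL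
  have hsplitℓ := integral_add_compl hA hℓ
  -- Tangent line of the logarithm at `1/3` on `A` and at `3` on the complement: the likelihood
  -- ratios of the outcomes when both errors are `1/4`.
  have b1 : ∫ x in A, ℓ x ∂μ ≤ ∫ x in A, (3 * Real.exp (ℓ x) - (1 + Real.log 3)) ∂μ := by
    refine integral_mono hℓ.restrict ((hL.const_mul 3).sub (integrable_const _)).restrict
      fun x => ?_
    have := Real.add_one_le_exp (ℓ x + Real.log 3)
    rw [Real.exp_add, Real.exp_log (by norm_num)] at this
    simp only
    linarith
  have b2 : ∫ x in Aᶜ, ℓ x ∂μ ≤ ∫ x in Aᶜ, (1 / 3 * Real.exp (ℓ x) - (1 - Real.log 3)) ∂μ := by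
    refine integral_mono hℓ.restrict ((hL.const_mul (1 / 3)).sub (integrable_const _)).restrict
      fun x => ?_
    have := Real.add_one_le_exp (ℓ x - Real.log 3)
    rw [Real.exp_sub, Real.exp_log (by norm_num)] at this
    simp only
    linarith
  rw [integral_sub (hL.const_mul 3).restrict (integrable_const _), integral_const_mul,
    integral_const, measureReal_restrict_apply_univ, smul_eq_mul, hA1] at b1
  rw [integral_sub (hL.const_mul _).restrict (integrable_const _), integral_const_mul,
    integral_const, measureReal_restrict_apply_univ, smul_eq_mul] at b2
  have hq0 : 0 ≤ μ.real Aᶜ := measureReal_nonneg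
  -- With `p = ∫_A exp ℓ` and `q = μ Aᶜ`, the two bounds add up to `8p/3 - 2/3 - log 3 + 2 q log 3`.
  -- For `p, q < 1/4` this is below `-(log 3) / 2 < -1/2`.
  nlinarith

/-! ### Likelihood ratio of adaptively collected data -/

section ChangeOfMeasure

variable {𝒮 𝒜 : Type*} [TopologicalSpace 𝒮] [MeasurableSpace 𝒮]
  [TopologicalSpace 𝒜] [MeasurableSpace 𝒜] {H : ℕ}
  {𝓑 : Type*} [NormedAddCommGroup 𝓑] [NormedSpace ℝ 𝓑] {ΘP Θr : Type*}
  {Ω : Type*} [mΩ : MeasurableSpace Ω] {Pr : Measure Ω} {n : ℕ}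

/-- The logarithm of the likelihood ratio between rewards of mean `r_θ` and of mean `0`. -/
def MDPFamily.logLik (M : MDPFamily 𝒮 𝒜 H 𝓑 ΘP Θr) (θ : Θr) {i : ℕ}
    (d : Fin i → Record 𝒮 𝒜 H) : ℝ :=
  ∑ j, (M.r θ (d j).1.1 (d j).1.2 * (d j).2.2 - M.r θ (d j).1.1 (d j).1.2 ^ 2 / 2)

theorem MDPFamily.measurable_logLik [OpensMeasurableSpace (𝒮 × 𝒜)]
    (M : MDPFamily 𝒮 𝒜 H 𝓑 ΘP Θr) (θ : Θr) (i : ℕ) :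
    Measurable (M.logLik θ : (Fin i → Record 𝒮 𝒜 H) → ℝ) := by
  refine Finset.measurable_sum _ fun j _ => ?_
  have hj : Measurable fun d : Fin i → Record 𝒮 𝒜 H => d j := measurable_pi_apply j
  have hr := (M.measurable_r θ).comp hj.fst
  exact (hr.mul hj.snd.snd).sub ((hr.pow_const 2).div_const 2)

/-- Under `θ₀` the recorded reward is the bare noise, so one access adds one Gaussian log-density
term; the choice of query is the same in both models and contributes nothing. -/
theorem MDPFamily.logLik_step (M : MDPFamily 𝒮 𝒜 H 𝓑 ΘP Θr) (ξ : Algorithm 𝒮 𝒜 H n) {θ₀ : Θr}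
    (h₀ : M.r θ₀ = 0) (θP : ΘP) (θ : Θr) (i : Fin n)
    (x : ((Fin i → Record 𝒮 𝒜 H) × ℝ) × ℝ × ℝ) :
    M.logLik θ (ξ.step M (θP, θ₀) i x) = M.logLik θ x.1.1
      + (M.r θ (ξ.query i x.1).1 (ξ.query i x.1).2 * x.2.2
        - M.r θ (ξ.query i x.1).1 (ξ.query i x.1).2 ^ 2 / 2) := by
  rw [MDPFamily.logLik, Fin.sum_univ_castSucc]
  simp [Algorithm.step, MDPFamily.logLik, h₀]

/-- Change of measure between rewards of mean `r_θ` and of mean `0`. -/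
theorem Algorithm.lintegral_data_eq [OpensMeasurableSpace (𝒮 × 𝒜)] [IsProbabilityMeasure Pr]
    (ξ : Algorithm 𝒮 𝒜 H n) (M : MDPFamily 𝒮 𝒜 H 𝓑 ΘP Θr) (N : Noise Pr) {θ₀ : Θr}
    (h₀ : M.r θ₀ = 0) (θP : ΘP) (θ : Θr) (i : ℕ) (hi : i ≤ n)
    {F : (Fin i → Record 𝒮 𝒜 H) × ℝ → ℝ≥0∞} (hF : Measurable F) :
    ∫⁻ ω, F (ξ.data M N (θP, θ) ω i hi, N.ubar ω) ∂Pr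
      = ∫⁻ ω, F (ξ.data M N (θP, θ₀) ω i hi, N.ubar ω)
          * ENNReal.ofReal (Real.exp (M.logLik θ (ξ.data M N (θP, θ₀) ω i hi))) ∂Pr := by
  induction i with
  | zero => simp [MDPFamily.logLik, Algorithm.data]
  | succ i ih =>
    have hi' := Nat.le_of_succ_le hi
    let γ := gaussianReal 0 1
    -- Fubini for the fresh noise of access `i`, valid under every reward parameter.
    have key : ∀ (θ' : Θr) (f : ((Fin i → Record 𝒮 𝒜 H) × ℝ) × ℝ × ℝ → ℝ≥0∞), Measurable f →
        ∫⁻ ω, f ((ξ.data M N (θP, θ') ω i hi', N.ubar ω), N.u i ω, N.ε i ω) ∂Pr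
          = ∫⁻ ω, ∫⁻ u, ∫⁻ e, f ((ξ.data M N (θP, θ') ω i hi', N.ubar ω), u, e) ∂γ ∂γ ∂Pr := by
      intro θ' f hf
      have hD := (ξ.measurable_data M N (θP, θ') i hi').prodMk N.measurable_ubar
      have hfi : Measurable fun x => ∫⁻ u, ∫⁻ e, f (x, u, e) ∂γ ∂γ := by
        refine Measurable.lintegral_prod_right' (f := fun y : ((Fin i → Record 𝒮 𝒜 H) × ℝ) × ℝ =>
          ∫⁻ e, f (y.1, y.2, e) ∂γ) ?_
        exact Measurable.lintegral_prod_right'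
          (f := fun y : (((Fin i → Record 𝒮 𝒜 H) × ℝ) × ℝ) × ℝ => f (y.1.1, y.1.2, y.2))
          (hf.comp (by fun_prop))
      rw [← lintegral_map (f := f)
          (g := fun ω => ((ξ.data M N (θP, θ') ω i hi', N.ubar ω), N.u i ω, N.ε i ω)) hf
          (hD.prodMk ((N.measurable_u i).prodMk (N.measurable_ε i))),
        ξ.map_data_noise M N (θP, θ') i hi', lintegral_prod _ hf.aemeasurable,
        ← lintegral_map (f := fun x => ∫⁻ u, ∫⁻ e, f (x, u, e) ∂γ ∂γ) hfi hD]
      refine lintegral_congr fun x => ?_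
      exact lintegral_prod _ (hf.comp measurable_prodMk_left).aemeasurable
    let k : Fin n := ⟨i, hi⟩
    let f₀ : ((Fin i → Record 𝒮 𝒜 H) × ℝ) × ℝ × ℝ → ℝ≥0∞ := fun x =>
      F (ξ.step M (θP, θ₀) k x, x.1.2) * ENNReal.ofReal (Real.exp
        (M.r θ (ξ.query k x.1).1 (ξ.query k x.1).2 * x.2.2
          - M.r θ (ξ.query k x.1).1 (ξ.query k x.1).2 ^ 2 / 2))
    have hstep : ∀ θ', Measurable fun x : ((Fin i → Record 𝒮 𝒜 H) × ℝ) × ℝ × ℝ =>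
        F (ξ.step M (θP, θ') k x, x.1.2) := fun θ' =>
      hF.comp ((ξ.measurable_step M (θP, θ') k).prodMk (by fun_prop))
    have hr : Measurable fun x : ((Fin i → Record 𝒮 𝒜 H) × ℝ) × ℝ × ℝ =>
        M.r θ (ξ.query k x.1).1 (ξ.query k x.1).2 :=
      (M.measurable_r θ).comp ((ξ.measurable_query k).comp measurable_fst)
    have hf₀ : Measurable f₀ := (hstep θ₀).mul
      ((hr.mul measurable_snd.snd).sub ((hr.pow_const 2).div_const 2)).exp.ennreal_ofReal
    -- With past data and transition noise fixed, changing the mean reward only translates the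
    -- reward noise.
    have shift : ∀ (x : (Fin i → Record 𝒮 𝒜 H) × ℝ) (u : ℝ),
        ∫⁻ e, F (ξ.step M (θP, θ) k (x, u, e), x.2) ∂γ = ∫⁻ e, f₀ (x, u, e) ∂γ := by
      intro x u
      have hs : Measurable fun e : ℝ => F (ξ.step M (θP, θ₀) k (x, u, e), x.2) :=
        (hstep θ₀).comp (f := fun e => (x, u, e)) (by fun_prop)
      have := lintegral_gaussianReal_const_add (M.r θ (ξ.query k x).1 (ξ.query k x).2) hs
      simp only [Algorithm.step, h₀, Pi.zero_apply, zero_add] at this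
      simpa only [Algorithm.step, f₀, h₀, Pi.zero_apply, zero_add] using this
    calc ∫⁻ ω, F (ξ.data M N (θP, θ) ω (i + 1) hi, N.ubar ω) ∂Pr
        = ∫⁻ ω, ∫⁻ u, ∫⁻ e, F (ξ.step M (θP, θ) k
            ((ξ.data M N (θP, θ) ω i hi', N.ubar ω), u, e), N.ubar ω) ∂γ ∂γ ∂Pr :=
          key θ _ (hstep θ)
      _ = ∫⁻ ω, ∫⁻ u, ∫⁻ e, f₀ ((ξ.data M N (θP, θ) ω i hi', N.ubar ω), u, e) ∂γ ∂γ ∂Pr :=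
          lintegral_congr fun ω => lintegral_congr fun u =>
            shift (ξ.data M N (θP, θ) ω i hi', N.ubar ω) u
      _ = ∫⁻ ω, (∫⁻ u, ∫⁻ e, f₀ ((ξ.data M N (θP, θ₀) ω i hi', N.ubar ω), u, e) ∂γ ∂γ)
            * ENNReal.ofReal (Real.exp (M.logLik θ (ξ.data M N (θP, θ₀) ω i hi'))) ∂Pr := by
          -- The fresh noise being integrated out, what remains is a function of the earlier data,
          -- to which the induction hypothesis applies.
          refine ih hi' (F := fun x => ∫⁻ u, ∫⁻ e, f₀ (x, u, e) ∂γ ∂γ) ?_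
          refine Measurable.lintegral_prod_right' (f := fun y : ((Fin i → Record 𝒮 𝒜 H) × ℝ) × ℝ =>
            ∫⁻ e, f₀ (y.1, y.2, e) ∂γ) ?_
          exact Measurable.lintegral_prod_right'
            (f := fun y : (((Fin i → Record 𝒮 𝒜 H) × ℝ) × ℝ) × ℝ => f₀ (y.1.1, y.1.2, y.2))
            (hf₀.comp (by fun_prop))
      _ = ∫⁻ ω, ∫⁻ u, ∫⁻ e, f₀ ((ξ.data M N (θP, θ₀) ω i hi', N.ubar ω), u, e)
            * ENNReal.ofReal (Real.exp (M.logLik θ (ξ.data M N (θP, θ₀) ω i hi'))) ∂γ ∂γ ∂Pr := by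
          refine lintegral_congr fun ω => ?_
          rw [← lintegral_mul_const' _ _ ENNReal.ofReal_ne_top]
          refine lintegral_congr fun u => ?_
          rw [← lintegral_mul_const' _ _ ENNReal.ofReal_ne_top]
      _ = ∫⁻ ω, f₀ ((ξ.data M N (θP, θ₀) ω i hi', N.ubar ω), N.u i ω, N.ε i ω)
            * ENNReal.ofReal (Real.exp (M.logLik θ (ξ.data M N (θP, θ₀) ω i hi'))) ∂Pr :=
          (key θ₀ (fun x => f₀ x * ENNReal.ofReal (Real.exp (M.logLik θ x.1.1)))
            (hf₀.mul ((M.measurable_logLik θ i).comp measurable_fst.fst).exp.ennreal_ofReal)).symm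
      _ = _ := by
          refine lintegral_congr fun ω => ?_
          rw [Algorithm.data_succ, M.logLik_step ξ h₀, Real.exp_add,
            ENNReal.ofReal_mul (Real.exp_pos _).le]
          simp only [f₀, k]
          ring

end ChangeOfMeasure

/-! ### Divergence of the data laws and indistinguishability -/

section Testing

variable {𝒮 𝒜 : Type*} [TopologicalSpace 𝒮] [MeasurableSpace 𝒮]
  [TopologicalSpace 𝒜] [MeasurableSpace 𝒜] {H : ℕ}
  {𝓑 : Type*} [NormedAddCommGroup 𝓑] [NormedSpace ℝ 𝓑] {ΘP Θr : Type*}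
  {Ω : Type*} [mΩ : MeasurableSpace Ω] {Pr : Measure Ω} {n : ℕ}

theorem MDPFamily.exists_abs_r_le (M : MDPFamily 𝒮 𝒜 H 𝓑 ΘP Θr) :
    ∃ B, ∀ θ h z, |M.r θ h z| ≤ B := by
  obtain ⟨B, hB, hM⟩ := M.incl_bound
  refine ⟨B, fun θ h z => ?_⟩
  have : M.r θ ∈ Set.range M.r := ⟨θ, rfl⟩
  rw [M.range_r] at this
  obtain ⟨g, hg, hgz⟩ := this h
  rw [hgz, ← Real.norm_eq_abs]
  exact ((M.incl g).norm_coe_le_norm z).trans ((hM g).trans (by nlinarith))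

theorem Algorithm.logLik_data (ξ : Algorithm 𝒮 𝒜 H n) (M : MDPFamily 𝒮 𝒜 H 𝓑 ΘP Θr)
    (N : Noise Pr) {θ₀ : Θr} (h₀ : M.r θ₀ = 0) (θP : ΘP) (θ : Θr) (ω : Ω) (i : ℕ) (hi : i ≤ n) :
    M.logLik θ (ξ.data M N (θP, θ₀) ω i hi) = ∑ j : Fin i,
      (fun q : Fin H × 𝒮 × 𝒜 => M.r θ q.1 q.2 * N.ε j ω - M.r θ q.1 q.2 ^ 2 / 2)
        (ξ.query (j.castLE hi) (ξ.data M N (θP, θ₀) ω j (j.2.le.trans hi), N.ubar ω)) := by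
  induction i with
  | zero => simp [MDPFamily.logLik]
  | succ i ih =>
    rw [Algorithm.data_succ, M.logLik_step ξ h₀, ih, Fin.sum_univ_castSucc]
    rfl

/-- The expected log-likelihood ratio is minus half the expected sum of the squared mean rewards. -/
theorem Algorithm.integral_logLik_data [OpensMeasurableSpace (𝒮 × 𝒜)] [IsProbabilityMeasure Pr]
    (ξ : Algorithm 𝒮 𝒜 H n) (M : MDPFamily 𝒮 𝒜 H 𝓑 ΘP Θr) (N : Noise Pr) {θ₀ : Θr}
    (h₀ : M.r θ₀ = 0) (θP : ΘP) (θ : Θr) :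
    Integrable (fun ω => M.logLik θ (ξ.data M N (θP, θ₀) ω n le_rfl)) Pr ∧
    ENNReal.ofReal (-2 * ∫ ω, M.logLik θ (ξ.data M N (θP, θ₀) ω n le_rfl) ∂Pr)
      = ∑ i : Fin n, ∫⁻ ω, (fun q : Fin H × 𝒮 × 𝒜 => ENNReal.ofReal (M.r θ q.1 q.2 ^ 2))
          (ξ.query i (ξ.data M N (θP, θ₀) ω i i.2.le, N.ubar ω)) ∂Pr := by
  obtain ⟨B, hB⟩ := M.exists_abs_r_le
  let R : Fin n → Ω → ℝ := fun i ω => (fun q : Fin H × 𝒮 × 𝒜 => M.r θ q.1 q.2)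
    (ξ.query i (ξ.data M N (θP, θ₀) ω i i.2.le, N.ubar ω))
  have hRm : ∀ i, Measurable (R i) := fun i => (M.measurable_r θ).comp
    ((ξ.measurable_query i).comp ((ξ.measurable_data M N (θP, θ₀) i i.2.le).prodMk
      N.measurable_ubar))
  have hR : ∀ i, Integrable (R i) Pr := fun i =>
    Integrable.of_bound (hRm i).aestronglyMeasurable B (.of_forall fun ω => hB _ _ _)
  have hR2 : ∀ i, Integrable (fun ω => R i ω ^ 2) Pr := fun i =>
    Integrable.of_bound ((hRm i).pow_const 2).aestronglyMeasurable (B ^ 2) (.of_forall fun ω => by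
      rw [Real.norm_eq_abs, abs_pow]
      exact pow_le_pow_left₀ (abs_nonneg _) (hB _ _ _) 2)
  have hε : ∀ i, Integrable (N.ε i) Pr := fun i => by
    have h : Integrable id (Pr.map (N.ε i)) := by
      rw [N.map_ε]; exact (memLp_id_gaussianReal 1).integrable le_rfl
    exact (integrable_map_measure h.1 (N.measurable_ε i).aemeasurable).1 h
  have hε0 : ∀ i, ∫ ω, N.ε i ω ∂Pr = 0 := fun i => by
    have h := integral_map (N.measurable_ε i).aemeasurable
      (f := fun x : ℝ => x) (μ := Pr) measurable_id.aestronglyMeasurable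
    rw [N.map_ε, integral_id_gaussianReal] at h
    exact h.symm
  -- The query is chosen before its reward noise is drawn, so the cross terms have mean zero and
  -- only the squares survive.
  have hind : ∀ i : Fin n, IndepFun (R i) (N.ε i) Pr := fun i =>
    (ξ.indepFun_data_noise M N (θP, θ₀) i i.2.le).comp
      ((M.measurable_r θ).comp (ξ.measurable_query i)) measurable_snd
  have hRε : ∀ i : Fin n, Integrable (fun ω => R i ω * N.ε i ω) Pr := fun i =>
    (hind i).integrable_mul (hR i) (hε i)
  have hRε0 : ∀ i : Fin n, ∫ ω, R i ω * N.ε i ω ∂Pr = 0 := fun i => by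
    have := (hind i).integral_mul_eq_mul_integral (hR i).1 (hε i).1
    rw [hε0, mul_zero] at this
    exact this
  have hlog : (fun ω => M.logLik θ (ξ.data M N (θP, θ₀) ω n le_rfl))
      = fun ω => ∑ i : Fin n, (R i ω * N.ε i ω - R i ω ^ 2 / 2) :=
    funext fun ω => ξ.logLik_data M N h₀ θP θ ω n le_rfl
  have hterm : ∀ i ∈ Finset.univ, Integrable (fun ω => R i ω * N.ε i ω - R i ω ^ 2 / 2) Pr :=
    fun i _ => (hRε i).sub ((hR2 i).div_const 2)
  rw [hlog]
  refine ⟨integrable_finsetSum _ hterm, ?_⟩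
  rw [integral_finsetSum _ hterm]
  have hone : ∀ i, ∫ ω, (R i ω * N.ε i ω - R i ω ^ 2 / 2) ∂Pr = -(∫ ω, R i ω ^ 2 ∂Pr) / 2 := by
    intro i
    rw [integral_sub (hRε i) ((hR2 i).div_const 2), hRε0, integral_div]
    ring
  simp only [hone]
  rw [Finset.mul_sum]
  have hnn : ∀ i, 0 ≤ ∫ ω, R i ω ^ 2 ∂Pr := fun i => integral_nonneg fun ω => sq_nonneg _
  have : ∀ i, -2 * (-(∫ ω, R i ω ^ 2 ∂Pr) / 2) = ∫ ω, R i ω ^ 2 ∂Pr := fun i => by ring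
  simp only [this]
  rw [ENNReal.ofReal_sum_of_nonneg fun i _ => hnn i]
  refine Finset.sum_congr rfl fun i _ => ?_
  exact ofReal_integral_eq_lintegral_ofReal (hR2 i) (.of_forall fun ω => sq_nonneg _)

/-- No test on the basis of the data distinguishes rewards of mean `0` from rewards of mean `r_θ`
if the sum of the expected squares of the latter at the queried points is at most `1`. -/
theorem Algorithm.one_fourth_le_or [OpensMeasurableSpace (𝒮 × 𝒜)] [IsProbabilityMeasure Pr]
    (ξ : Algorithm 𝒮 𝒜 H n) (M : MDPFamily 𝒮 𝒜 H 𝓑 ΘP Θr) (N : Noise Pr) {θ₀ : Θr}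
    (h₀ : M.r θ₀ = 0) (θP : ΘP) (θ : Θr)
    (hle : ∑ i : Fin n, ∫⁻ ω, (fun q : Fin H × 𝒮 × 𝒜 => ENNReal.ofReal (M.r θ q.1 q.2 ^ 2))
          (ξ.query i (ξ.data M N (θP, θ₀) ω i i.2.le, N.ubar ω)) ∂Pr ≤ 1)
    {E : Set ℝ} (hE : MeasurableSet E) :
    1 / 4 ≤ Pr {ω | ξ.estimate M N (θP, θ₀) ω ∉ E} ∨
      1 / 4 ≤ Pr {ω | ξ.estimate M N (θP, θ) ω ∈ E} := by
  obtain ⟨hint, heq⟩ := ξ.integral_logLik_data M N h₀ θP θ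
  have hest : ∀ θ', Measurable (ξ.estimate M N θ') := fun θ' => ξ.measurable_output.comp
    ((ξ.measurable_data M N θ' n le_rfl).prodMk N.measurable_ubar)
  -- The change of measure applied to the constant `1` shows that the likelihood ratio has total
  -- mass one.
  have hone : ∫⁻ ω, ENNReal.ofReal (Real.exp (M.logLik θ (ξ.data M N (θP, θ₀) ω n le_rfl))) ∂Pr
      = 1 := by
    have := ξ.lintegral_data_eq M N h₀ θP θ n le_rfl (F := fun _ => 1) measurable_const
    simpa using this.symm
  have hhalf : -(1 / 2) ≤ ∫ ω, M.logLik θ (ξ.data M N (θP, θ₀) ω n le_rfl) ∂Pr := by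
    rw [← heq, ENNReal.ofReal_le_one] at hle
    linarith
  have hA : MeasurableSet (ξ.estimate M N (θP, θ₀) ⁻¹' E) := hest _ hE
  have htilt : Pr {ω | ξ.estimate M N (θP, θ) ω ∈ E}
      = ∫⁻ ω in ξ.estimate M N (θP, θ₀) ⁻¹' E,
          ENNReal.ofReal (Real.exp (M.logLik θ (ξ.data M N (θP, θ₀) ω n le_rfl))) ∂Pr := by
    have := ξ.lintegral_data_eq M N h₀ θP θ n le_rfl
      (F := (ξ.output ⁻¹' E).indicator 1) (measurable_one.indicator (ξ.measurable_output hE))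
    rw [← lintegral_indicator hA]
    refine (lintegral_indicator_one (hest (θP, θ) hE)).symm.trans (Eq.trans ?_ (this.trans ?_))
    · rfl
    · refine lintegral_congr fun ω => ?_
      by_cases hω : ξ.estimate M N (θP, θ₀) ω ∈ E
      · rw [Set.indicator_of_mem (by exact hω), Set.indicator_of_mem (by exact hω)]
        simp
      · rw [Set.indicator_of_notMem (by exact hω), Set.indicator_of_notMem (by exact hω)]
        simp
  rw [htilt]
  exact one_fourth_le_or_of_neg_half_le_integral Pr hint hone hhalf hA

end Testing

/-! ### Optimal values and the lower bound for a fixed algorithm -/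

section LowerBound

theorem isProbabilityMeasure_stateActionLaw {𝒮 𝒜 : Type*} [MeasurableSpace 𝒮] [MeasurableSpace 𝒜]
    {H : ℕ} (P : Fin H → Kernel (𝒮 × 𝒜) 𝒮) (hP : ∀ h, IsMarkovKernel (P h))
    (π : Policy 𝒮 𝒜 H) (μ : Measure 𝒮) [IsProbabilityMeasure μ] (h : ℕ) (hh : h < H) :
    IsProbabilityMeasure (stateActionLaw P π μ h hh) := by
  have hπ := π.isMarkov
  induction h with
  | zero => rw [stateActionLaw]; infer_instance
  | succ h ih =>
    rw [stateActionLaw]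
    have := ih (Nat.lt_of_succ_lt hh)
    infer_instance

variable {𝒮 𝒜 : Type*} [TopologicalSpace 𝒮] [MeasurableSpace 𝒮]
  [TopologicalSpace 𝒜] [MeasurableSpace 𝒜] {H : ℕ}
  {𝓑 : Type*} [NormedAddCommGroup 𝓑] [NormedSpace ℝ 𝓑] {ΘP Θr : Type*}
  {Ω : Type*} [mΩ : MeasurableSpace Ω] {Pr : Measure Ω} {n : ℕ}

/-- Every reward that vanishes off one step and is there in the unit ball of `𝓑` is realized. -/
theorem MDPFamily.exists_r_eq_single (M : MDPFamily 𝒮 𝒜 H 𝓑 ΘP Θr) (h₀ : Fin H) {g : 𝓑}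
    (hg : ‖g‖ ≤ 1) : ∃ θ, M.r θ = Pi.single h₀ (M.incl g : 𝒮 × 𝒜 → ℝ) := by
  change _ ∈ Set.range M.r
  rw [M.range_r]
  intro h
  rcases eq_or_ne h h₀ with rfl | hne
  · exact ⟨g, hg, fun z => by simp⟩
  · exact ⟨0, by simp, fun z => by simp [hne]⟩

theorem MDPFamily.exists_r_eq_zero (M : MDPFamily 𝒮 𝒜 H 𝓑 ΘP Θr) : ∃ θ, M.r θ = 0 := by
  change _ ∈ Set.range M.r
  rw [M.range_r]
  exact fun h => ⟨0, by simp, fun z => by simp⟩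

theorem MDPFamily.optimalValue_eq_zero (M : MDPFamily 𝒮 𝒜 H 𝓑 ΘP Θr) {θ : ΘP × Θr}
    (hθ : M.r θ.2 = 0) : M.optimalValue θ = 0 := by
  simp [MDPFamily.optimalValue, optimalReward, totalReward, hθ]

theorem MDPFamily.abs_integral_le (M : MDPFamily 𝒮 𝒜 H 𝓑 ΘP Θr) (θP : ΘP) (π : Policy 𝒮 𝒜 H)
    (h : Fin H) {f : 𝒮 × 𝒜 → ℝ} {B : ℝ} (hf : ∀ z, |f z| ≤ B) :
    |∫ z, f z ∂(stateActionLaw (M.P θP) π M.μ h.1 h.2)| ≤ B := by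
  have := M.isProbabilityMeasure_μ
  have := isProbabilityMeasure_stateActionLaw (M.P θP) (M.isMarkov_P θP) π M.μ h.1 h.2
  simpa using norm_integral_le_of_norm_le_const
    (μ := stateActionLaw (M.P θP) π M.μ h.1 h.2) (f := f) (C := B)
    (.of_forall fun z => hf z)

theorem MDPFamily.totalReward_le_optimalValue (M : MDPFamily 𝒮 𝒜 H 𝓑 ΘP Θr) (θ : ΘP × Θr)
    (π : Policy 𝒮 𝒜 H) : totalReward (M.P θ.1) (M.r θ.2) M.μ π ≤ M.optimalValue θ := by
  obtain ⟨B, hB⟩ := M.exists_abs_r_le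
  -- A real supremum dominates its members only if the family is bounded above; the uniform bound on
  -- rewards provides this.
  refine le_ciSup (f := fun π => totalReward (M.P θ.1) (M.r θ.2) M.μ π) ⟨∑ _h : Fin H, B, ?_⟩ π
  rintro _ ⟨π, rfl⟩
  exact Finset.sum_le_sum fun h _ =>
    (le_abs_self _).trans (M.abs_integral_le θ.1 π h (hB θ.2 h))

theorem MDPFamily.integral_le_optimalValue (M : MDPFamily 𝒮 𝒜 H 𝓑 ΘP Θr) {θ : ΘP × Θr}
    {h₀ : Fin H} {g : 𝒮 × 𝒜 → ℝ} (hθ : M.r θ.2 = Pi.single h₀ g) (π : Policy 𝒮 𝒜 H) :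
    ∫ z, g z ∂(stateActionLaw (M.P θ.1) π M.μ h₀.1 h₀.2) ≤ M.optimalValue θ := by
  refine le_of_eq_of_le ?_ (M.totalReward_le_optimalValue θ π)
  rw [totalReward, hθ, Finset.sum_eq_single h₀ (fun h _ hne => by simp [hne]) (by simp)]
  simp

/-- This makes the complexity finite, so that two thirds of it, when positive, lie strictly below
it. -/
theorem exists_perturbationResponse_le (M : MDPFamily 𝒮 𝒜 H 𝓑 ΘP Θr) :
    ∃ B : ℝ, ∀ θP ε ν, perturbationResponse M (reachable (M.P θP) M.μ) ε ν ≤ ENNReal.ofReal B := by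
  obtain ⟨B, hB, hM⟩ := M.incl_bound
  refine ⟨B, fun θP ε ν => iSup₂_le fun g hg => iSup₂_le fun ρ hρ => ?_⟩
  obtain ⟨h, π, rfl⟩ := Set.mem_iUnion.1 hρ
  refine ENNReal.ofReal_le_ofReal (M.abs_integral_le θP π h fun z => ?_)
  exact ((M.incl g).norm_coe_le_norm z).trans ((hM g).trans (by nlinarith [hg.1]))

theorem neg_mem_perturbationSpace {M : MDPFamily 𝒮 𝒜 H 𝓑 ΘP Θr} {ε : ℝ} {ν : Measure (𝒮 × 𝒜)}
    {g : 𝓑} (hg : g ∈ perturbationSpace M ε ν) : -g ∈ perturbationSpace M ε ν := by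
  refine ⟨by simpa using hg.1, ?_⟩
  have : (M.incl (-g) : 𝒮 × 𝒜 → ℝ) = -(M.incl g : 𝒮 × 𝒜 → ℝ) := by rw [map_neg]; rfl
  rw [this, eLpNorm_neg]
  exact hg.2

theorem perturbationalComplexity_le (M : MDPFamily 𝒮 𝒜 H 𝓑 ΘP Θr) (N : Noise Pr) {ε : ℝ}
    (hε : ⌊1 / ε ^ 2⌋₊ = n) (ξ : SamplingScheme 𝒮 𝒜 H n) :
    perturbationalComplexity M N ε ≤ ⨆ θ : ΘP × Θr,
      perturbationResponse M (reachable (M.P θ.1) M.μ) ε (ξ.averageLaw M N θ) := by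
  subst hε
  exact iInf_le _ ξ

/-- A function of small norm in `L²` of the average law has small squares at the queried points. -/
theorem sum_lintegral_sq_le {Z : Type*} [MeasurableSpace Z] {f : Z → ℝ} (hf : Measurable f)
    (hn : 0 < n) {X : Fin n → Ω → Z} (hX : ∀ i, Measurable (X i)) {ε : ℝ}
    (hε : ENNReal.ofReal ε ^ 2 = (n : ℝ≥0∞)⁻¹)
    (h : eLpNorm f 2 ((n : ℝ≥0∞)⁻¹ • ∑ i, Pr.map (X i)) ≤ ENNReal.ofReal ε) :
    ∑ i, ∫⁻ ω, ENNReal.ofReal (f (X i ω) ^ 2) ∂Pr ≤ 1 := by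
  have h2 := eLpNorm_nnreal_pow_eq_lintegral (f := f) (p := 2)
    (μ := (n : ℝ≥0∞)⁻¹ • ∑ i, Pr.map (X i)) two_ne_zero
  simp only [NNReal.coe_ofNat, ENNReal.coe_ofNat, ENNReal.rpow_ofNat] at h2
  have hsq : ∀ z, ‖f z‖ₑ ^ 2 = ENNReal.ofReal (f z ^ 2) := fun z => by
    rw [Real.enorm_eq_ofReal_abs, ← ENNReal.ofReal_pow (abs_nonneg _), sq_abs]
  simp only [hsq] at h2
  rw [lintegral_smul_measure, lintegral_finsetSum_measure, smul_eq_mul] at h2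
  have h3 := pow_le_pow_left₀ zero_le h 2
  rw [h2, hε] at h3
  have hn0 : (n : ℝ≥0∞)⁻¹ ≠ 0 := by simp
  have hnt : (n : ℝ≥0∞)⁻¹ ≠ ∞ := by simpa using hn.ne'
  have h4 : ∀ i, ∫⁻ z, ENNReal.ofReal (f z ^ 2) ∂(Pr.map (X i))
      = ∫⁻ ω, ENNReal.ofReal (f (X i ω) ^ 2) ∂Pr := fun i =>
    lintegral_map (hf.pow_const 2).ennreal_ofReal (hX i)
  simp only [h4] at h3
  -- The average of the `n` expected squares is at most `ε² = 1/n`; the factor `1/n` cancels.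
  exact (ENNReal.mul_le_mul_iff_right hn0 hnt).1 (h3.trans_eq (mul_one _).symm)

/-- Every algorithm errs by a third of the perturbational complexity with probability `1/4`. -/
theorem Algorithm.one_fourth_le_iSup [OpensMeasurableSpace (𝒮 × 𝒜)] [IsProbabilityMeasure Pr]
    [Nonempty ΘP] (hn : 0 < n) (ξ : Algorithm 𝒮 𝒜 H n) (M : MDPFamily 𝒮 𝒜 H 𝓑 ΘP Θr)
    (N : Noise Pr) {ε : ℝ} (hε : 1 / ε ^ 2 = n) (hε0 : 0 < ε) :
    (1 / 4 : ℝ≥0∞) ≤ ⨆ θ : ΘP × Θr, Pr {ω | 1 / 3 * perturbationalComplexity M N ε ≤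
      ENNReal.ofReal |ξ.estimate M N θ ω - M.optimalValue θ|} := by
  obtain ⟨θ₀, h₀⟩ := M.exists_r_eq_zero
  obtain ⟨ξ', hξ'⟩ := ξ.exists_scheme M N h₀
  have hΔ := perturbationalComplexity_le M N (by rw [hε, Nat.floor_natCast]) ξ'
  set Δ := perturbationalComplexity M N ε
  have hthird : 1 / 3 * Δ = Δ / 3 := by rw [one_div, mul_comm, ENNReal.div_eq_inv_mul, mul_comm]
  rw [hthird]
  rcases eq_or_ne Δ 0 with hΔ0 | hΔ0
  -- For `Δ = 0` the event is the whole space.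
  · refine le_iSup_of_le (Classical.arbitrary ΘP, θ₀) ?_
    simp [hΔ0]
  have hΔt : Δ ≠ ∞ := by
    obtain ⟨B, hB⟩ := exists_perturbationResponse_le M
    exact ((hΔ.trans (iSup_le fun θ => hB _ _ _)).trans_lt ENNReal.ofReal_lt_top).ne
  -- The suprema need not be attained; aiming at `2Δ/3` instead of `Δ` gives the strict inequality
  -- needed to extract near-maximizers.
  have hlt : Δ / 3 + Δ / 3 < Δ := by
    have h3t : Δ / 3 ≠ ∞ := ENNReal.div_ne_top hΔt (by norm_num)
    have h30 : Δ / 3 ≠ 0 := by simp [hΔ0]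
    calc Δ / 3 + Δ / 3 < Δ / 3 + Δ / 3 + Δ / 3 :=
          ENNReal.lt_add_right (ENNReal.add_ne_top.2 ⟨h3t, h3t⟩) h30
      _ = Δ := ENNReal.add_thirds Δ
  obtain ⟨θ, hθ⟩ := lt_iSup_iff.1 (hlt.trans_le hΔ)
  obtain ⟨g, hg⟩ := lt_iSup_iff.1 hθ
  obtain ⟨hgmem, hg⟩ := lt_iSup_iff.1 hg
  obtain ⟨ρ, hρ⟩ := lt_iSup_iff.1 hg
  obtain ⟨hρmem, hρ⟩ := lt_iSup_iff.1 hρ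
  clear hθ hg
  obtain ⟨g', hg', hgρ⟩ : ∃ g' ∈ perturbationSpace M ε (ξ'.averageLaw M N θ),
      Δ / 3 + Δ / 3 < ENNReal.ofReal (∫ z, M.incl g' z ∂ρ) := by
    rcases abs_choice (∫ z, M.incl g z ∂ρ) with h | h
    · exact ⟨g, hgmem, by rwa [h] at hρ⟩
    · refine ⟨-g, neg_mem_perturbationSpace hgmem, ?_⟩
      rw [h, ← integral_neg] at hρ
      simpa using hρ
  obtain ⟨h₁, π, rfl⟩ := Set.mem_iUnion.1 hρmem
  obtain ⟨θ₁, hθ₁⟩ := M.exists_r_eq_single h₁ hg'.1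
  have hJ := M.integral_le_optimalValue (θ := (θ.1, θ₁)) hθ₁ π
  have hJ1 : Δ / 3 + Δ / 3 < ENNReal.ofReal (M.optimalValue (θ.1, θ₁)) :=
    hgρ.trans_le (ENNReal.ofReal_le_ofReal hJ)
  have hε2 : ENNReal.ofReal ε ^ 2 = (n : ℝ≥0∞)⁻¹ := by
    rw [← ENNReal.ofReal_pow hε0.le, ← ENNReal.ofReal_natCast n, ← hε,
      ← ENNReal.ofReal_inv_of_pos (by positivity)]
    simp
  have hqm : ∀ i : Fin n, Measurable fun ω =>
      (ξ.query i (ξ.data M N (θ.1, θ₀) ω i i.2.le, N.ubar ω)).2 := fun i =>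
    ((ξ.measurable_query i).comp ((ξ.measurable_data M N (θ.1, θ₀) i i.2.le).prodMk
      N.measurable_ubar)).snd
  have hsum := sum_lintegral_sq_le (Pr := Pr) (M.incl g').continuous.measurable hn hqm hε2
    (by rw [← hξ' θ]; exact hg'.2)
  have hle : ∑ i : Fin n, ∫⁻ ω,
      (fun q : Fin H × 𝒮 × 𝒜 => ENNReal.ofReal (M.r θ₁ q.1 q.2 ^ 2))
          (ξ.query i (ξ.data M N (θ.1, θ₀) ω i i.2.le, N.ubar ω)) ∂Pr ≤ 1 := by
    -- The law `ν` forgets the step, so its `L²` norm counts every query; the chosen reward is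
    -- nonzero only at step `h₁`, which can only decrease the sum.
    refine (Finset.sum_le_sum fun i _ => lintegral_mono fun ω => ?_).trans hsum
    refine ENNReal.ofReal_le_ofReal ?_
    rw [hθ₁]
    set q := ξ.query i (ξ.data M N (θ.1, θ₀) ω i i.2.le, N.ubar ω)
    rcases eq_or_ne q.1 h₁ with h | h
    · rw [h, Pi.single_eq_same]
    · rw [Pi.single_eq_of_ne h]
      simpa using sq_nonneg _
  -- The test accepts zero rewards when the estimate is within `Δ/3` of `0`, the optimal value
  -- there.
  have hE : MeasurableSet {x : ℝ | ENNReal.ofReal |x| < Δ / 3} :=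
    measurableSet_lt (by fun_prop) measurable_const
  rcases ξ.one_fourth_le_or M N h₀ θ.1 θ₁ hle hE with h | h
  · refine (h.trans (measure_mono fun ω hω => ?_)).trans
      (le_iSup (fun θ => Pr {ω | Δ / 3 ≤
        ENNReal.ofReal |ξ.estimate M N θ ω - M.optimalValue θ|}) (θ.1, θ₀))
    simpa [M.optimalValue_eq_zero (θ := (θ.1, θ₀)) h₀] using hω
  · refine (h.trans (measure_mono fun ω hω => ?_)).trans
      (le_iSup (fun θ => Pr {ω | Δ / 3 ≤
        ENNReal.ofReal |ξ.estimate M N θ ω - M.optimalValue θ|}) (θ.1, θ₁))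
    -- An estimate within `Δ/3` of both `0` and the other optimal value would make the latter
    -- smaller than `2Δ/3`.
    by_contra hcon
    rw [Set.mem_ofPred_eq, not_le] at hcon
    refine lt_irrefl _ (hJ1.trans ?_)
    refine lt_of_le_of_lt ?_ (ENNReal.add_lt_add (show _ < Δ / 3 from hω) hcon)
    rw [← ENNReal.ofReal_add (abs_nonneg _) (abs_nonneg _)]
    refine ENNReal.ofReal_le_ofReal ?_
    have h1 := le_abs_self (ξ.estimate M N (θ.1, θ₁) ω)
    have h2 := neg_abs_le (ξ.estimate M N (θ.1, θ₁) ω - M.optimalValue (θ.1, θ₁))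
    linarith

end LowerBound

end RLLowerBound

end

/-! ### The minimax bounds in probability and in expectation -/

theorem theorem2 {dS dA : ℕ} (S : Set (EuclideanSpace ℝ (Fin dS)))
    (A : Set (EuclideanSpace ℝ (Fin dA))) (hA : IsCompact A) (hA' : A.Nonempty)
    (H : ℕ) (hH : 0 < H)
    {𝓑 : Type*} [NormedAddCommGroup 𝓑] [NormedSpace ℝ 𝓑] [CompleteSpace 𝓑]
    {ΘP Θr : Type*} [Nonempty ΘP]
    (M : MDPFamily S A H 𝓑 ΘP Θr)
    {Ω : Type*} [MeasurableSpace Ω] (Pr : Measure Ω) [IsProbabilityMeasure Pr] (N : Noise Pr)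
    (n : ℕ) (hn : 0 < n) :
    (1 / 4 : ℝ≥0∞) ≤
        ⨅ ξ : Algorithm S A H n, ⨆ θ : ΘP × Θr,
          Pr {ω | 1 / 3 * perturbationalComplexity M N ((n : ℝ) ^ (-(1 / 2) : ℝ)) ≤
            ENNReal.ofReal |ξ.estimate M N θ ω - M.optimalValue θ|} ∧
      1 / 12 * perturbationalComplexity M N ((n : ℝ) ^ (-(1 / 2) : ℝ)) ≤
        ⨅ ξ : Algorithm S A H n, ⨆ θ : ΘP × Θr,
          ∫⁻ ω, ENNReal.ofReal |ξ.estimate M N θ ω - M.optimalValue θ| ∂Pr := by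
  have hn' : (0 : ℝ) < n := Nat.cast_pos.2 hn
  have hε0 : 0 < (n : ℝ) ^ (-(1 / 2) : ℝ) := Real.rpow_pos_of_pos hn' _
  have hε : 1 / ((n : ℝ) ^ (-(1 / 2) : ℝ)) ^ 2 = n := by
    rw [← Real.rpow_natCast, ← Real.rpow_mul hn'.le]
    norm_num [Real.rpow_neg_one]
  have main := fun ξ : Algorithm S A H n => ξ.one_fourth_le_iSup hn M N hε hε0
  refine ⟨le_iInf main, le_iInf fun ξ => ?_⟩
  set Δ := perturbationalComplexity M N ((n : ℝ) ^ (-(1 / 2) : ℝ))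
  have h12 : 1 / 12 * Δ = 1 / 3 * Δ * (1 / 4) := by
    have : (1 / 12 : ℝ≥0∞) = 1 / 3 * (1 / 4) := by
      rw [one_div, one_div, one_div, ← ENNReal.mul_inv (by norm_num) (by norm_num)]
      norm_num
    rw [this]; ring
  rw [h12]
  refine (mul_le_mul_right (main ξ) _).trans ?_
  rw [ENNReal.mul_iSup]
  -- Markov's inequality at threshold `Δ/3`, for each parameter separately.
  refine iSup_mono fun θ => mul_meas_ge_le_lintegral₀ ?_ _
  have hest : Measurable (ξ.estimate M N θ) := ξ.measurable_output.comp
    ((ξ.measurable_data M N θ n le_rfl).prodMk N.measurable_ubar)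
  fun_prop
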